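/- Let $d \ge 0$ be an integer and $0 < p \le 2$, and let $L^p(\mathbb{R}^d)$ denote the complex vector space of (classes of) complex-valued $p$-integrable functions on $\mathbb{R}^d$ with Lebesgue measure. For $x, y \in \mathbb{R}^d$ let $T_x f(t) = f(t-x)$ and $M_y f(t) = e^{2\pi i\, y\cdot t} f(t)$. Let $\Gamma$ and $\Lambda$ be lattices in $\mathbb{R}^d$, i.e. discrete subgroups of finite covolume (equivalently, discrete subgroups that span $\mathbb{R}^d$ over $\mathbb{R}$). Let $A \subseteq \mathbb{R}^d \times \mathbb{R}^d$ be a (finite or infinite) set some translate of which is contained in the product lattice $\Gamma \times \Lambda$. Then for every $f \in L^p(\mathbb{R}^d)$ with $f \neq 0$ the Gabor system $\mathcal{G}(f,A) = \{ M_y T_x f : (x,y) \in A \}$ is linearly independent over $\mathbb{C}$ as a family in $L^p(\mathbb{R}^d)$ indexed by $A$: if $(x_1,y_1),\dots,(x_N,y_N) \in A$ are distinct and $c_1,\dots,c_N \in \mathbb{C}$ satisfy $\sum_{k=1}^N c_k\, e^{2\pi i\, y_k\cdot t} f(t-x_k) = 0$ for almost every $t \in \mathbb{R}^d$, then $c_1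 = \dots = c_N = 0$. -/

import Mathlib

open MeasureTheory
open scoped ENNReal

namespace Gabor

noncomputable section

/-- The translate `t ↦ f (t - x)` of a function on `ℝ^d`. -/
def translateFun {d : ℕ} (x : EuclideanSpace ℝ (Fin d)) (f : EuclideanSpace ℝ (Fin d) → ℂ) :
    EuclideanSpace ℝ (Fin d) → ℂ :=
  fun t => f (t - x)

/-- The modulate `t ↦ e^{2πi y·t} f t` of a function on `ℝ^d`. -/
def modulateFun {d : ℕ} (y : EuclideanSpace ℝ (Fin d)) (f : EuclideanSpace ℝ (Fin d) → ℂ) :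
    EuclideanSpace ℝ (Fin d) → ℂ :=
  fun t => Complex.exp (2 * Real.pi * Complex.I * (inner ℝ y t : ℝ)) * f t

theorem memLp_translateFun {d : ℕ} {p : ℝ≥0∞} (x : EuclideanSpace ℝ (Fin d))
    {f : EuclideanSpace ℝ (Fin d) → ℂ} (hf : MemLp f p volume) :
    MemLp (translateFun x f) p volume :=
  hf.comp_measurePreserving (measurePreserving_sub_right volume x)

theorem memLp_modulateFun {d : ℕ} {p : ℝ≥0∞} (y : EuclideanSpace ℝ (Fin d))
    {f : EuclideanSpace ℝ (Fin d) → ℂ} (hf : MemLp f p volume) :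
    MemLp (modulateFun y f) p volume := by
  have hc : Continuous fun t : EuclideanSpace ℝ (Fin d) =>
      Complex.exp (2 * Real.pi * Complex.I * (inner ℝ y t : ℝ)) := by
    fun_prop
  refine hf.congr_norm (hc.aestronglyMeasurable.mul hf.aestronglyMeasurable)
    (Filter.Eventually.of_forall fun t => ?_)
  have h : (2 * Real.pi * Complex.I * (inner ℝ y t : ℝ) : ℂ)
      = ((2 * Real.pi * inner ℝ y t : ℝ) : ℂ) * Complex.I := by
    push_cast
    ring
  simp only [modulateFun]
  rw [norm_mul, h, Complex.norm_exp_ofReal_mul_I, one_mul]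

/-- The translation operator `T_x` on `L^p(ℝ^d)`, `T_x f (t) = f (t - x)`. -/
def translation {d : ℕ} {p : ℝ≥0∞} (x : EuclideanSpace ℝ (Fin d))
    (f : Lp ℂ p (volume : Measure (EuclideanSpace ℝ (Fin d)))) :
    Lp ℂ p (volume : Measure (EuclideanSpace ℝ (Fin d))) :=
  (memLp_translateFun x (Lp.memLp f)).toLp

/-- The modulation operator `M_y` on `L^p(ℝ^d)`, `M_y f (t) = e^{2πi y·t} f (t)`. -/
def modulation {d : ℕ} {p : ℝ≥0∞} (y : EuclideanSpace ℝ (Fin d))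
    (f : Lp ℂ p (volume : Measure (EuclideanSpace ℝ (Fin d)))) :
    Lp ℂ p (volume : Measure (EuclideanSpace ℝ (Fin d))) :=
  (memLp_modulateFun y (Lp.memLp f)).toLp

/-- The Gabor system `G(f, A) = {M_y T_x f : (x, y) ∈ A}` in `L^p(ℝ^d)`, as a family indexed
by `A`. -/
def gaborSystem {d : ℕ} {p : ℝ≥0∞}
    (f : Lp ℂ p (volume : Measure (EuclideanSpace ℝ (Fin d))))
    (A : Set (EuclideanSpace ℝ (Fin d) × EuclideanSpace ℝ (Fin d))) :
    A → Lp ℂ p (volume : Measure (EuclideanSpace ℝ (Fin d))) :=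
  fun a => modulation a.1.2 (translation a.1.1 f)

end

end Gabor

/-! Shift the relation into Γ × Λ and group its terms by translation: along each Γ-orbit it becomes
a difference equation ∑ P_γ(t) g(t - γ) = 0. Each P_γ is a nontrivial trigonometric polynomial, so
it is nonzero a.e., and it is periodic under a lattice L that pairs integrally with Λ. Since p ≤ 2,
g is square summable along almost every orbit.

On a finite window F of an orbit, the equations at the points of F' are independent, so a solution
can put at most the fraction q n of its window mass at n, with ∑ q n = #F - #F'
(`exists_eval_bound_of_differenceEquation`). The q n depend only on the coefficients, hence serve
all L-translates of t at once and bound the supremum h over L of the relative mass of g. This h is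
L-periodic, so its integral over a fundamental domain D of L is unchanged by shifts along Γ, and #F
∫_D h ≤ (#F - #F') vol D. For large boxes #F'/#F tends to 1, so h = 0 a.e. and g = 0
(`ae_eq_zero_of_differenceEquation`). -/

/-- A subspace `V` of `ℂ^ι` has evaluation bounds `q i` (the diagonal entries of the orthogonal
projection onto `V`) whose sum is the dimension of `V`. -/
theorem Submodule.exists_eval_bound {ι : Type*} [Fintype ι]
    (V : Submodule ℂ (EuclideanSpace ℂ ι)) :
    ∃ q : ι → ℝ, (∀ i, 0 ≤ q i) ∧ ∑ i, q i = Module.finrank ℂ V ∧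
      ∀ b ∈ V, ∀ i, ‖b i‖ ^ 2 ≤ q i * ∑ j, ‖b j‖ ^ 2 := by
  let u := stdOrthonormalBasis ℂ V
  refine ⟨fun i => ∑ k, ‖(u k : EuclideanSpace ℂ ι) i‖ ^ 2,
    fun i => Finset.sum_nonneg fun k _ => by positivity, ?_, ?_⟩
  · rw [Finset.sum_comm]
    have h (k) : ∑ i, ‖(u k : EuclideanSpace ℂ ι) i‖ ^ 2 = 1 := by
      rw [← EuclideanSpace.norm_sq_eq]
      have := u.orthonormal.1 k
      rw [Submodule.norm_coe, this, one_pow]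
    simp [h]
  · intro b hb i
    have hrepr : b i = ∑ k, u.repr ⟨b, hb⟩ k * (u k : EuclideanSpace ℂ ι) i := by
      have h := congrArg (fun v : V => (v : EuclideanSpace ℂ ι) i) (u.sum_repr ⟨b, hb⟩)
      simpa using h.symm
    have hnorm : ∑ k, ‖u.repr ⟨b, hb⟩ k‖ ^ 2 = ∑ j, ‖b j‖ ^ 2 := by
      rw [← EuclideanSpace.norm_sq_eq, ← EuclideanSpace.norm_sq_eq, u.repr.norm_map]
      rfl
    rw [hrepr, ← hnorm, mul_comm]
    calc _ ≤ (∑ k, ‖u.repr ⟨b, hb⟩ k‖ * ‖(u k : EuclideanSpace ℂ ι) i‖) ^ 2 := by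
          gcongr
          exact (norm_sum_le _ _).trans_eq (by simp)
      _ ≤ _ := Finset.sum_mul_sq_le_sq_mul_sq _ _ _

/-! ### Difference equations on finite windows. -/

section DifferenceEquation

variable {G : Type*} [AddCommGroup G] [DecidableEq G]

/-- The matrix of the difference operator `b ↦ (m ↦ ∑ γ ∈ S, w γ m * b (m - γ))`. -/
def differenceMatrix (S F F' : Finset G) (w : G → G → ℂ) : Matrix F' F ℂ :=
  Matrix.of fun m n => if (m : G) - n ∈ S then w (m - n) m else 0

theorem differenceMatrix_mulVec {S F F' : Finset G} (hF : ∀ m ∈ F', ∀ γ ∈ S, m - γ ∈ F)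
    (w : G → G → ℂ) (b : G → ℂ) (m : F') :
    (differenceMatrix S F F' w).mulVec (fun n => b n) m = ∑ γ ∈ S, w γ m * b (m - γ) := by
  simp only [Matrix.mulVec, dotProduct, differenceMatrix, Matrix.of_apply, ite_mul, zero_mul]
  rw [Finset.sum_coe_sort F
    (fun n => if (m : G) - n ∈ S then w (m - n) m * b n else 0), ← Finset.sum_filter]
  refine Finset.sum_nbij' (fun n => m - n) (fun γ => m - γ) ?_ ?_ ?_ ?_ ?_
  · intro n hn
    exact (Finset.mem_filter.1 hn).2
  · intro γ hγ
    simp [hγ, hF m m.2 γ hγ]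
  all_goals simp

/-- If a + (-γ) is a unique sum of the support of a row relation and -S, then in column a - γ only
row a contributes, and its entry is nonzero. -/
theorem linearIndependent_row_differenceMatrix [UniqueSums G] {S F F' : Finset G}
    (hS : S.Nonempty) (hF : ∀ m ∈ F', ∀ γ ∈ S, m - γ ∈ F) {w : G → G → ℂ}
    (hw : ∀ γ ∈ S, ∀ m ∈ F', w γ m ≠ 0) :
    LinearIndependent ℂ (differenceMatrix S F F' w).row := by
  rw [Fintype.linearIndependent_iff]
  intro u hu
  by_contra! hne
  obtain ⟨m₁, hm₁⟩ := hne
  let A : Finset G := (Finset.univ.filter fun m : F' => u m ≠ 0).map (Function.Embedding.subtype _)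
  have hA : A.Nonempty := ⟨m₁, by simpa [A] using hm₁⟩
  obtain ⟨a, ha, b, hb, hab⟩ := UniqueSums.uniqueAdd_of_nonempty hA (hS.image fun γ => -γ)
  obtain ⟨γ, hγ, rfl⟩ := Finset.mem_image.1 hb
  obtain ⟨ha', hua⟩ : ∃ h : a ∈ F', u ⟨a, h⟩ ≠ 0 := by simpa [A] using ha
  have h := congrFun hu ⟨a - γ, hF a ha' γ hγ⟩
  simp only [Finset.sum_apply, Pi.smul_apply, Matrix.row, differenceMatrix, Matrix.of_apply,
    smul_eq_mul, Pi.zero_apply] at h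
  rw [Fintype.sum_eq_single ⟨a, ha'⟩] at h
  · simp [hγ, hua, hw γ hγ a ha'] at h
  · intro m hm
    by_cases hum : u m = 0
    · simp [hum]
    · rw [if_neg, mul_zero]
      intro hmem
      refine hm (Subtype.ext ?_)
      refine (hab (a := m) (b := -(m - (a - γ))) ?_ ?_ (by abel)).1
      · simpa [A] using hum
      · exact Finset.mem_image_of_mem _ hmem

/-- On a finite window `F`, the solutions of a difference equation which is imposed on `F'` and
whose coefficients do not vanish obey evaluation bounds whose sum is `#F - #F'`. -/
theorem exists_eval_bound_of_differenceEquation [UniqueSums G] {S F F' : Finset G}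
    (hS : S.Nonempty) (hF : ∀ m ∈ F', ∀ γ ∈ S, m - γ ∈ F) {w : G → G → ℂ}
    (hw : ∀ γ ∈ S, ∀ m ∈ F', w γ m ≠ 0) :
    ∃ q : G → ℝ, (∀ n, 0 ≤ q n) ∧ ∑ n ∈ F, q n + F'.card = F.card ∧
      ∀ b : G → ℂ, (∀ m ∈ F', ∑ γ ∈ S, w γ m * b (m - γ) = 0) →
        ∀ n ∈ F, ‖b n‖ ^ 2 ≤ q n * ∑ m ∈ F, ‖b m‖ ^ 2 := by
  let M := differenceMatrix S F F' w
  let T : EuclideanSpace ℂ F →ₗ[ℂ] (F' → ℂ) :=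
    M.mulVecLin ∘ₗ (WithLp.linearEquiv 2 ℂ (F → ℂ)).toLinearMap
  have hrange : Module.finrank ℂ (LinearMap.range T) = F'.card := by
    have : LinearMap.range T = LinearMap.range M.mulVecLin :=
      LinearMap.range_comp_of_range_eq_top _ (LinearEquiv.range _)
    rw [this]
    have h := (linearIndependent_row_differenceMatrix hS hF hw).rank_matrix
    simpa [Matrix.rank] using h
  have hker := LinearMap.finrank_range_add_finrank_ker T
  rw [hrange, finrank_euclideanSpace, Fintype.card_coe] at hker
  obtain ⟨q, hq0, hq, hqb⟩ := (LinearMap.ker T).exists_eval_bound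
  refine ⟨fun n => if h : n ∈ F then q ⟨n, h⟩ else 0, ?_, ?_, ?_⟩
  · intro n
    dsimp only
    split_ifs with h
    exacts [hq0 _, le_rfl]
  · rw [← Finset.sum_coe_sort F]
    have h (x : F) : (if h : (x : G) ∈ F then q ⟨x, h⟩ else 0) = q x := dif_pos x.2
    rw [Finset.sum_congr rfl fun x _ => h x, hq, ← hker]
    push_cast
    ring
  · intro b hb n hn
    have hmem : WithLp.toLp 2 (fun n : F => b n) ∈ LinearMap.ker T := by
      rw [LinearMap.mem_ker]
      ext m
      simpa [T] using (differenceMatrix_mulVec hF w b m).trans (hb m m.2)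
    have h := hqb _ hmem ⟨n, hn⟩
    rw [← Finset.sum_coe_sort F]
    simpa [hn] using h

end DifferenceEquation

/-! ### Averaging over growing boxes. -/

section Averaging

open Filter Topology Pointwise

/-- The box `[-R, N + R)` in `ℤ^d`. -/
noncomputable def latticeBox (d R N : ℕ) : Finset (Fin d → ℤ) :=
  Fintype.piFinset fun _ => Finset.Ico (-R : ℤ) (N + R)

theorem mem_latticeBox {d R N : ℕ} {n : Fin d → ℤ} :
    n ∈ latticeBox d R N ↔ ∀ i, -(R : ℤ) ≤ n i ∧ n i < N + R := by
  simp [latticeBox]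

theorem card_latticeBox (d R N : ℕ) : (latticeBox d R N).card = (N + 2 * R) ^ d := by
  simp only [latticeBox, Fintype.card_piFinset, Int.card_Ico, Finset.prod_const,
    Finset.card_univ, Fintype.card_fin]
  congr 1
  omega

theorem exists_sub_mem_latticeBox {d : ℕ} (S : Finset (Fin d → ℤ)) :
    ∃ R : ℕ, ∀ N, ∀ m ∈ latticeBox d 0 N, ∀ γ ∈ S, m - γ ∈ latticeBox d R N := by
  refine ⟨∑ γ ∈ S, ∑ i, (γ i).natAbs, fun N m hm γ hγ => mem_latticeBox.2 fun i => ?_⟩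
  have h1 : (γ i).natAbs ≤ ∑ γ ∈ S, ∑ i, (γ i).natAbs :=
    (Finset.single_le_sum (f := fun i => (γ i).natAbs) (fun _ _ => Nat.zero_le _)
      (Finset.mem_univ i)).trans
      (Finset.single_le_sum (f := fun γ : Fin d → ℤ => ∑ i, (γ i).natAbs)
        (fun _ _ => Nat.zero_le _) hγ)
  have h2 := mem_latticeBox.1 hm i
  rw [Pi.sub_apply]
  omega

/-- The boundary layer of width R is negligible: the ratio of the two cardinalities tends to 1. -/
theorem eq_zero_of_card_latticeBox_le {d R : ℕ} {H v : ℝ≥0∞} (hv : v ≠ ∞)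
    (h : ∀ N : ℕ, (latticeBox d R N).card * H + (latticeBox d 0 N).card * v ≤
      (latticeBox d R N).card * v) : H = 0 := by
  have hlim : Tendsto (fun N : ℕ => ((N : ℝ) / (N + 2 * R)) ^ d) atTop (𝓝 1) := by
    simpa using (tendsto_natCast_div_add_atTop (2 * (R : ℝ))).pow d
  have hH : H ≠ ∞ := by
    rintro rfl
    -- N = 1 makes the box nonempty even if R = 0.
    have h1 := h 1
    rw [ENNReal.mul_top (by simp [card_latticeBox]), top_add, top_le_iff] at h1
    exact ENNReal.mul_ne_top (ENNReal.natCast_ne_top _) hv h1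
  lift H to NNReal using hH
  lift v to NNReal using hv
  have hle : ∀ᶠ N : ℕ in atTop, (H : ℝ) + ((N : ℝ) / (N + 2 * R)) ^ d * v ≤ v := by
    filter_upwards [eventually_gt_atTop 0] with N hN
    have hN' : (0 : ℝ) < N := by exact_mod_cast hN
    have hpos : (0 : ℝ) < ((N : ℝ) + 2 * R) ^ d := by positivity
    have h1 : ((latticeBox d R N).card * H + (latticeBox d 0 N).card * v : ℝ) ≤
      (latticeBox d R N).card * v := by exact_mod_cast h N
    simp only [card_latticeBox, mul_zero, add_zero] at h1
    push_cast at h1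
    rw [div_pow]
    refine le_of_mul_le_mul_left ?_ hpos
    calc _ = ((N : ℝ) + 2 * R) ^ d * H + (N : ℝ) ^ d * v := by field_simp
      _ ≤ _ := h1
  have hle' := le_of_tendsto ((hlim.mul_const (v : ℝ)).const_add (H : ℝ)) hle
  have h0 : (H : ℝ) ≤ 0 := by linarith
  have : H = 0 := le_antisymm (by exact_mod_cast h0) zero_le
  simp [this]

variable {d : ℕ} {E : Type*} [AddCommGroup E]

/-- The mass of `g` at `t` relative to its total mass on the orbit of `t`. -/
noncomputable def relMass (e : (Fin d → ℤ) →+ E) (g : E → ℂ) (t : E) : ℝ≥0∞ :=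
  ‖g t‖ₑ ^ 2 / ∑' n, ‖g (t + e n)‖ₑ ^ 2

theorem relMass_add_le {e : (Fin d → ℤ) →+ E} {g : E → ℂ} {t : E} {F : Finset (Fin d → ℤ)}
    {n : Fin d → ℤ} {q : ℝ} (hq : 0 ≤ q)
    (h : ‖g (t + e n)‖ ^ 2 ≤ q * ∑ m ∈ F, ‖g (t + e m)‖ ^ 2) :
    relMass e g (t + e n) ≤ ENNReal.ofReal q := by
  have hS : ∑' m, ‖g (t + e n + e m)‖ₑ ^ 2 = ∑' m, ‖g (t + e m)‖ₑ ^ 2 := by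
    rw [← (Equiv.addLeft n).tsum_eq fun m => ‖g (t + e m)‖ₑ ^ 2]
    simp [add_assoc]
  rw [relMass, hS]
  refine ENNReal.div_le_of_le_mul ?_
  calc ‖g (t + e n)‖ₑ ^ 2 = ENNReal.ofReal (‖g (t + e n)‖ ^ 2) := by
        rw [ENNReal.ofReal_pow (norm_nonneg _), ofReal_norm]
    _ ≤ ENNReal.ofReal (q * ∑ m ∈ F, ‖g (t + e m)‖ ^ 2) := ENNReal.ofReal_le_ofReal h
    _ = ENNReal.ofReal q * ∑ m ∈ F, ‖g (t + e m)‖ₑ ^ 2 := by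
        rw [ENNReal.ofReal_mul hq, ENNReal.ofReal_sum_of_nonneg fun _ _ => by positivity]
        simp [ENNReal.ofReal_pow]
    _ ≤ _ := by
        gcongr
        exact ENNReal.sum_le_tsum F

/-- A function which is square summable along the orbits of `ℤ^d` and solves a difference equation
whose coefficients are nonvanishing and periodic for a cocompact group vanishes. -/
theorem ae_eq_zero_of_differenceEquation [MeasurableSpace E] [MeasurableAdd₂ E]
    {μ : Measure E} [μ.IsAddLeftInvariant] (e : (Fin d → ℤ) →+ E)
    (L : AddSubgroup E) [Countable L] {D : Set E} (hD : IsAddFundamentalDomain L D μ)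
    (hDfin : μ D ≠ ∞) {S : Finset (Fin d → ℤ)} (hS : S.Nonempty) {P : (Fin d → ℤ) → E → ℂ}
    (hPper : ∀ γ ∈ S, ∀ l ∈ L, ∀ t, P γ (t + l) = P γ t)
    (hPne : ∀ γ ∈ S, ∀ᵐ t ∂μ, P γ t ≠ 0) {g : E → ℂ} (hg : Measurable g)
    (hsum : ∀ᵐ t ∂μ, ∑' n, ‖g (t + e n)‖ₑ ^ 2 ≠ ∞)
    (heq : ∀ᵐ t ∂μ, ∑ γ ∈ S, P γ t * g (t - e γ) = 0) : ∀ᵐ t ∂μ, g t = 0 := by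
  have : μ.IsAddRightInvariant := inferInstance
  -- The supremum makes h periodic under L, which `relMass` itself need not be.
  have htrans {p : E → Prop} (hp : ∀ᵐ t ∂μ, p t) (x : E) : ∀ᵐ t ∂μ, p (t + x) :=
    (measurePreserving_add_right μ x).quasiMeasurePreserving.ae hp
  let h : E → ℝ≥0∞ := fun t => ⨆ l : L, relMass e g (t + l)
  have hrm : Measurable (relMass e g) := by
    unfold relMass
    refine (hg.enorm.pow_const 2).div (Measurable.tsum fun n => ?_)
    exact (hg.comp (measurable_add_const _)).enorm.pow_const 2
  have hmeas : Measurable h := .iSup fun l => hrm.comp (measurable_add_const _)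
  have hper (l : L) (t : E) : h (l +ᵥ t) = h t := by
    refine (Equiv.addLeft l).iSup_congr fun k => ?_
    congr 1
    simp only [Equiv.coe_addLeft, AddSubgroup.vadd_def, vadd_eq_add, AddSubgroup.coe_add]
    abel
  have hint (x : E) : ∫⁻ t in D, h (t + x) ∂μ = ∫⁻ t in D, h t ∂μ := by
    have hDx : IsAddFundamentalDomain L (x +ᵥ D) μ := hD.vadd_of_comm x
    rw [hD.setLIntegral_eq hDx h hper]
    have := (measurePreserving_vadd x μ).setLIntegral_comp_emb
      (measurableEmbedding_const_vadd x) h D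
    rw [Set.image_vadd] at this
    rw [← this]
    simp [add_comm]
  have hmeas' (x : E) : Measurable fun t => h (t + x) := hmeas.comp (measurable_add_const x)
  obtain ⟨R, hR⟩ := exists_sub_mem_latticeBox S
  have hPne' : ∀ᵐ t ∂μ, ∀ γ ∈ S, ∀ n, P γ (t + e n) ≠ 0 :=
    (ae_ball_iff S.countable_toSet).2 fun γ hγ => ae_all_iff.2 fun n => htrans (hPne γ hγ) _
  have heq' : ∀ᵐ t ∂μ, ∀ l : L, ∀ n,
      ∑ γ ∈ S, P γ (t + l + e n) * g (t + l + e n - e γ) = 0 :=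
    ae_all_iff.2 fun l => ae_all_iff.2 fun n => htrans (htrans heq (e n)) l
  have hle (N : ℕ) : ∀ᵐ t ∂μ, ∑ n ∈ latticeBox d R N, h (t + e n) + (latticeBox d 0 N).card ≤
      (latticeBox d R N).card := by
    filter_upwards [hPne', heq'] with t ht1 ht2
    -- q is chosen before l; periodicity of P makes it valid for every l.
    obtain ⟨q, hq0, hq, hqb⟩ := exists_eval_bound_of_differenceEquation hS (hR N)
      (w := fun γ m => P γ (t + e m)) fun γ hγ m _ => ht1 γ hγ m
    have hh : ∀ n ∈ latticeBox d R N, h (t + e n) ≤ ENNReal.ofReal (q n) := by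
      intro n hn
      refine iSup_le fun l => ?_
      rw [add_right_comm]
      refine relMass_add_le (hq0 n) (hqb (fun n => g (t + l + e n)) (fun m _ => ?_) n hn)
      rw [← ht2 l m]
      refine Finset.sum_congr rfl fun γ hγ => ?_
      rw [add_right_comm t (l : E) (e m), hPper γ hγ l l.2, map_sub]
      congr 2
      abel
    calc _ ≤ ∑ n ∈ latticeBox d R N, ENNReal.ofReal (q n) + (latticeBox d 0 N).card := by
          gcongr with n hn
          exact hh n hn
      _ = ENNReal.ofReal (∑ n ∈ latticeBox d R N, q n + (latticeBox d 0 N).card) := by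
          rw [ENNReal.ofReal_add (Finset.sum_nonneg fun n _ => hq0 n) (by positivity),
            ENNReal.ofReal_sum_of_nonneg fun n _ => hq0 n, ENNReal.ofReal_natCast]
      _ = _ := by rw [hq, ENNReal.ofReal_natCast]
  have hzero : ∫⁻ t in D, h t ∂μ = 0 := by
    refine eq_zero_of_card_latticeBox_le (d := d) (R := R) hDfin fun N => ?_
    have h1 := lintegral_mono_ae (ae_restrict_of_ae (s := D) (hle N))
    rw [lintegral_add_right _ measurable_const,
      lintegral_finsetSum _ fun n _ => hmeas' (e n)] at h1
    simpa [hint] using h1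
  have hae : ∀ᵐ t ∂μ, h t = 0 := by
    have h1 : ∫⁻ t, h t ∂μ = 0 := by
      rw [hD.lintegral_eq_tsum'']
      simp [hper, hzero]
    exact (lintegral_eq_zero_iff hmeas).1 h1
  filter_upwards [hae, hsum] with t ht1 ht2
  have h0 : relMass e g t = 0 := by
    have := (ENNReal.iSup_eq_zero.1 ht1) 0
    simpa using this
  -- Square summability excludes a quotient that vanishes through an infinite denominator.
  simpa [relMass, ENNReal.div_eq_zero_iff, ht2] using h0

end Averaging

/-! ### Zero sets of trigonometric polynomials. -/

section TrigPolynomial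

/-- The character `s ↦ e^{2πi a s}` of `ℝ`. -/
noncomputable def expChar (a : ℝ) : Multiplicative ℝ →* ℂ where
  toFun s := Complex.exp (2 * Real.pi * Complex.I * (a * s.toAdd : ℝ))
  map_one' := by simp
  map_mul' x y := by
    rw [← Complex.exp_add]
    congr 1
    simp
    ring

theorem expChar_injective : Function.Injective expChar := by
  intro a b hab
  have hd (a : ℝ) : HasDerivAt (fun s : ℝ => Complex.exp (2 * Real.pi * Complex.I * (a * s : ℝ)))
      (2 * Real.pi * Complex.I * a) 0 := by
    have h1 : HasDerivAt (fun s : ℝ => ((a * s : ℝ) : ℂ)) a 0 := by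
      simpa using ((hasDerivAt_id (0 : ℝ)).const_mul a).ofReal_comp
    simpa using (h1.const_mul (2 * Real.pi * Complex.I)).cexp
  have hf : (fun s : ℝ => Complex.exp (2 * Real.pi * Complex.I * (a * s : ℝ))) =
      fun s : ℝ => Complex.exp (2 * Real.pi * Complex.I * (b * s : ℝ)) := by
    funext s
    exact DFunLike.congr_fun hab (Multiplicative.ofAdd s)
  have h := (hd a).unique (hf ▸ hd b)
  simpa [Real.pi_ne_zero, Complex.I_ne_zero] using h

/-- A nontrivial exponential sum on the line vanishes on a null set only. -/
theorem ae_exponentialSum_ne_zero {ι : Type*} {J : Finset ι} {a : ι → ℝ}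
    (ha : Set.InjOn a J) {c : ι → ℂ} (hc : ∃ j ∈ J, c j ≠ 0) :
    ∀ᵐ s : ℝ, ∑ j ∈ J, c j * Complex.exp (2 * Real.pi * Complex.I * (a j * s : ℝ)) ≠ 0 := by
  set φ : ℝ → ℂ := fun s => ∑ j ∈ J, c j * Complex.exp (2 * Real.pi * Complex.I * (a j * s : ℝ))
  have han : AnalyticOnNhd ℝ φ Set.univ := by
    intro s _
    refine Finset.analyticAt_fun_sum _ fun j _ => ?_
    have h : AnalyticAt ℝ (fun s : ℝ => 2 * Real.pi * Complex.I * ((a j * s : ℝ) : ℂ)) s :=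
      analyticAt_const.mul
        ((Complex.ofRealCLM.analyticAt _).comp (analyticAt_const.mul analyticAt_id))
    exact analyticAt_const.mul
      ((Complex.differentiable_exp.analyticAt _).restrictScalars (𝕜 := ℝ) |>.comp h)
  rcases han.eqOn_zero_or_eventually_ne_zero_of_preconnected isPreconnected_univ with h | h
  · exfalso
    obtain ⟨j, hj, hcj⟩ := hc
    refine hcj ?_
    -- Dedekind: distinct characters are linearly independent.
    have hli := (linearIndependent_monoidHom (Multiplicative ℝ) ℂ).comp
      (fun j : J => expChar (a j)) fun i j hij => Subtype.ext (ha i.2 j.2 (expChar_injective hij))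
    rw [Fintype.linearIndependent_iff] at hli
    refine hli (fun j => c j) ?_ ⟨j, hj⟩
    funext s
    have := h (Set.mem_univ s.toAdd)
    simp only [φ] at this
    rw [← Finset.sum_coe_sort J] at this
    simpa [expChar] using this
  · have := ae_restrict_le_codiscreteWithin (μ := (volume : Measure ℝ)) MeasurableSet.univ h
    rwa [Measure.restrict_univ] at this

/-- A nontrivial trigonometric polynomial vanishes on a null set only. -/
theorem ae_trigPolynomial_ne_zero {E : Type*} [NormedAddCommGroup E] [InnerProductSpace ℝ E]
    [FiniteDimensional ℝ E] [MeasurableSpace E] [BorelSpace E] (μ : Measure E)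
    [μ.IsAddHaarMeasure] {ι : Type*} {J : Finset ι} {y : ι → E} (hy : Set.InjOn y J)
    {c : ι → ℂ} (hc : ∃ j ∈ J, c j ≠ 0) :
    ∀ᵐ t ∂μ, ∑ j ∈ J, c j * Complex.exp (2 * Real.pi * Complex.I * (inner ℝ (y j) t : ℝ)) ≠ 0 := by
  -- A direction v separating the frequencies reduces the claim, by Fubini, to lines parallel to v.
  obtain ⟨f, hf⟩ := Module.exists_dual_forall_apply_ne_zero (K := ℝ)
    (fun k : {k : J × J // k.1 ≠ k.2} => y k.1.1 - y k.1.2)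
    (fun k => sub_ne_zero.2 fun h => k.2 (Subtype.ext (hy k.1.1.2 k.1.2.2 h)))
  let v : E := (InnerProductSpace.toDual ℝ E).symm (LinearMap.toContinuousLinearMap f)
  have hv (x : E) : inner ℝ x v = f x := by
    rw [real_inner_comm]
    simp [v]
  have hinj : Set.InjOn (fun j => inner ℝ (y j) v) J := by
    intro i hi j hj hij
    by_contra hne
    refine hf ⟨(⟨i, hi⟩, ⟨j, hj⟩), fun h => hne (congrArg Subtype.val h)⟩ ?_
    simp only [hv] at hij
    simp [map_sub, hij]
  have hmeas : MeasurableSet {t : E |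
      ∑ j ∈ J, c j * Complex.exp (2 * Real.pi * Complex.I * (inner ℝ (y j) t : ℝ)) ≠ 0} := by
    have : Continuous fun t : E =>
        ∑ j ∈ J, c j * Complex.exp (2 * Real.pi * Complex.I * (inner ℝ (y j) t : ℝ)) := by
      fun_prop
    exact (isOpen_ne_fun this continuous_const).measurableSet
  refine ae_mem_of_ae_add_linearMap_mem (LinearMap.toSpanSingleton ℝ E v) volume μ hmeas
    fun t => ?_
  have h := ae_exponentialSum_ne_zero hinj (c := fun j => c j *
    Complex.exp (2 * Real.pi * Complex.I * (inner ℝ (y j) t : ℝ)))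
    (by obtain ⟨j, hj, hcj⟩ := hc; exact ⟨j, hj, mul_ne_zero hcj (Complex.exp_ne_zero _)⟩)
  filter_upwards [h] with s hs
  convert hs using 3 with j
  rw [mul_assoc (c j), ← Complex.exp_add]
  congr 2
  simp [inner_add_right, inner_smul_right]
  ring

end TrigPolynomial

/-! ### Summability along lattice orbits and dual lattices. -/

section Lattice

theorem ENNReal.tsum_sq_ne_top_of_tsum_rpow_ne_top {ι : Type*} {a : ι → ℝ≥0∞} {r : ℝ}
    (hr0 : 0 < r) (hr2 : r ≤ 2) (h : ∑' i, a i ^ r ≠ ∞) : ∑' i, a i ^ 2 ≠ ∞ := by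
  set C := ∑' i, a i ^ r
  have ha (i) : a i ^ 2 ≤ (C ^ r⁻¹) ^ (2 - r) * a i ^ r := by
    have h1 : a i ≤ C ^ r⁻¹ := by
      rw [ENNReal.le_rpow_inv_iff hr0]
      exact ENNReal.le_tsum i
    calc a i ^ 2 = a i ^ ((2 - r) + r) := by simp
      _ = a i ^ (2 - r) * a i ^ r := ENNReal.rpow_add_of_nonneg _ _ (by linarith) hr0.le
      _ ≤ _ := by gcongr
  refine ne_top_of_le_ne_top ?_ (ENNReal.tsum_le_tsum ha)
  rw [ENNReal.tsum_mul_left]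
  exact ENNReal.mul_ne_top (ENNReal.rpow_ne_top_of_nonneg (by linarith)
    (ENNReal.rpow_ne_top_of_nonneg (by positivity) h)) h

/-- Unfolding ∫ |f|^p over D gives ℓ^p along almost every orbit, and ℓ^p ⊆ ℓ^2 for p ≤ 2. -/
theorem MeasureTheory.MemLp.ae_tsum_sq_ne_top {E : Type*} [AddCommGroup E] [MeasurableSpace E]
    [MeasurableAdd₂ E] {μ : Measure E} [μ.IsAddLeftInvariant] {Γ : AddSubgroup E} [Countable Γ]
    {D : Set E} (hD : IsAddFundamentalDomain Γ D μ) {p : ℝ≥0∞} (hp0 : 0 < p) (hp2 : p ≤ 2)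
    {f : E → ℂ} (hfm : Measurable f) (hf : MemLp f p μ) :
    ∀ᵐ t ∂μ, ∑' γ : Γ, ‖f (γ + t)‖ₑ ^ 2 ≠ ∞ := by
  have hp : p ≠ ∞ := ne_top_of_le_ne_top (by simp) hp2
  have hr0 : 0 < p.toReal := ENNReal.toReal_pos hp0.ne' hp
  have hr2 : p.toReal ≤ 2 := ENNReal.toReal_le_of_le_ofReal (by simp) (by simpa using hp2)
  set k : E → ℝ≥0∞ := fun t => ∑' γ : Γ, ‖f (γ + t)‖ₑ ^ p.toReal
  have hfin := lintegral_rpow_enorm_lt_top_of_eLpNorm_lt_top hp0.ne' hp hf.2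
  have hterm (γ : Γ) : Measurable fun t => ‖f (γ + t)‖ₑ ^ p.toReal :=
    (hfm.comp (measurable_const_add _)).enorm.pow_const _
  have hk : ∀ᵐ t ∂μ.restrict D, k t < ∞ := by
    refine ae_lt_top (Measurable.tsum hterm) ?_
    rw [lintegral_tsum fun γ => (hterm γ).aemeasurable]
    rw [hD.lintegral_eq_tsum''] at hfin
    exact hfin.ne
  have hk' := ae_imp_of_ae_restrict hk
  have hk'' : ∀ᵐ t ∂μ, ∀ γ : Γ, (γ : E) + t ∈ D → k (γ + t) < ∞ :=
    ae_all_iff.2 fun γ => (measurePreserving_add_left μ (γ : E)).quasiMeasurePreserving.ae hk'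
  filter_upwards [hk'', hD.ae_covers] with t ht ⟨γ, hγ⟩
  have hkt : k (γ + t) = k t := by
    have := (Equiv.addRight γ).tsum_eq fun δ : Γ => ‖f (δ + t)‖ₑ ^ p.toReal
    simpa [k, add_assoc] using this
  exact ENNReal.tsum_sq_ne_top_of_tsum_rpow_ne_top hr0 hr2 (hkt ▸ ht γ hγ).ne

variable {d : ℕ} (Γ : Submodule ℤ (EuclideanSpace ℝ (Fin d))) [DiscreteTopology Γ]
  [IsZLattice ℝ Γ]

theorem exists_finBasis_of_isZLattice : Nonempty (Module.Basis (Fin d) ℤ Γ) :=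
  ⟨(Module.Free.chooseBasis ℤ Γ).reindex (Fintype.equivOfCardEq (by
    rw [← Module.finrank_eq_card_chooseBasisIndex, ZLattice.rank ℝ, finrank_euclideanSpace]))⟩

theorem exists_dualBasis_of_isZLattice :
    ∃ b : Module.Basis (Fin d) ℝ (EuclideanSpace ℝ (Fin d)),
      ∀ y ∈ Γ, ∀ l ∈ Submodule.span ℤ (Set.range b), ∃ k : ℤ, inner ℝ y l = k := by
  obtain ⟨c⟩ := exists_finBasis_of_isZLattice Γ
  let c' := c.ofZLatticeBasis ℝ
  let b : Module.Basis (Fin d) ℝ (EuclideanSpace ℝ (Fin d)) :=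
    (c'.dualBasis.map LinearMap.toContinuousLinearMap).map
      (InnerProductSpace.toDual ℝ _).symm.toLinearEquiv
  have hb (i j) : inner ℝ (c' j) (b i) = if j = i then 1 else 0 := by
    rw [real_inner_comm]
    simp [b, Finsupp.single_apply]
  refine ⟨b, fun y hy l hl => ?_⟩
  rw [← c.ofZLatticeBasis_span ℝ] at hy
  induction hy, hl using Submodule.span_induction₂ with
  | mem_mem x y hx hy =>
    obtain ⟨i, rfl⟩ := hx
    obtain ⟨j, rfl⟩ := hy
    exact ⟨if i = j then 1 else 0, by rw [hb]; split_ifs <;> simp⟩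
  | zero_left y hy => exact ⟨0, by simp⟩
  | zero_right x hx => exact ⟨0, by simp⟩
  | add_left x y z hx hy hz h1 h2 =>
    obtain ⟨⟨k, hk⟩, m, hm⟩ := h1, h2
    exact ⟨k + m, by rw [inner_add_left, hk, hm]; push_cast; rfl⟩
  | add_right x y z hx hy hz h1 h2 =>
    obtain ⟨⟨k, hk⟩, m, hm⟩ := h1, h2
    exact ⟨k + m, by rw [inner_add_right, hk, hm]; push_cast; rfl⟩
  | smul_left r x y hx hy h =>
    obtain ⟨k, hk⟩ := h
    refine ⟨r * k, ?_⟩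
    rw [← Int.cast_smul_eq_zsmul ℝ, real_inner_smul_left, hk]
    push_cast
    rfl
  | smul_right r x y hx hy h =>
    obtain ⟨k, hk⟩ := h
    refine ⟨r * k, ?_⟩
    rw [← Int.cast_smul_eq_zsmul ℝ, real_inner_smul_right, hk]
    push_cast
    rfl

end Lattice

/-! ### From Gabor relations to difference equations. -/

section Gabor

variable {d : ℕ}

/-- A function in `L^p`, `p ≤ 2`, which satisfies a nontrivial linear relation between
time-frequency shifts in a product of lattices vanishes. -/
theorem ae_eq_zero_of_timeFrequency_relation {p : ℝ≥0∞} (hp0 : 0 < p) (hp2 : p ≤ 2)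
    (Γ Λ : Submodule ℤ (EuclideanSpace ℝ (Fin d)))
    [DiscreteTopology Γ] [IsZLattice ℝ Γ] [DiscreteTopology Λ] [IsZLattice ℝ Λ]
    {g : EuclideanSpace ℝ (Fin d) → ℂ} (hgm : Measurable g) (hg : MemLp g p volume)
    {ι : Type*} {J : Finset ι} {x : ι → Γ} {y : ι → EuclideanSpace ℝ (Fin d)}
    (hy : ∀ j, y j ∈ Λ) (hinj : Set.InjOn (fun j => (x j, y j)) J) {c : ι → ℂ}
    (hc : ∃ j ∈ J, c j ≠ 0)
    (heq : ∀ᵐ t, ∑ j ∈ J, c j * Complex.exp (2 * Real.pi * Complex.I * (inner ℝ (y j) t : ℝ)) *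
      g (t - x j) = 0) : ∀ᵐ t, g t = 0 := by
  classical
  obtain ⟨cΓ⟩ := exists_finBasis_of_isZLattice Γ
  obtain ⟨b, hb⟩ := exists_dualBasis_of_isZLattice Λ
  let ε : (Fin d → ℤ) ≃+ Γ := cΓ.equivFun.symm.toAddEquiv
  let e : (Fin d → ℤ) →+ EuclideanSpace ℝ (Fin d) :=
    Γ.subtype.toAddMonoidHom.comp ε.toAddMonoidHom
  have he (n) : e n = ε n := rfl
  -- Without zero coefficients, every P γ with γ in the image of n is nontrivial.
  let J' := J.filter fun j => c j ≠ 0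
  let n : ι → Fin d → ℤ := fun j => ε.symm (x j)
  let P : (Fin d → ℤ) → EuclideanSpace ℝ (Fin d) → ℂ := fun γ t => ∑ j ∈ J' with n j = γ,
    c j * Complex.exp (2 * Real.pi * Complex.I * (inner ℝ (y j) t : ℝ))
  have : Countable Γ.toAddSubgroup := inferInstanceAs (Countable Γ)
  have : Countable (Submodule.span ℤ (Set.range b)).toAddSubgroup :=
    inferInstanceAs (Countable (Submodule.span ℤ (Set.range b)))
  have hΓ := ZLattice.isAddFundamentalDomain cΓ (volume : Measure (EuclideanSpace ℝ (Fin d)))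
  have hsq := MemLp.ae_tsum_sq_ne_top (Γ := Γ.toAddSubgroup) hΓ hp0 hp2 hgm hg
  refine ae_eq_zero_of_differenceEquation e (Submodule.span ℤ (Set.range b)).toAddSubgroup
    (ZSpan.isAddFundamentalDomain' b volume)
    (ZSpan.fundamentalDomain_isBounded b).measure_lt_top.ne (S := J'.image n) (P := P)
    ?_ ?_ ?_ hgm ?_ ?_
  · obtain ⟨j, hj, hcj⟩ := hc
    exact ⟨n j, Finset.mem_image_of_mem _ (by simp [J', hj, hcj])⟩
  · intro γ _ l hl t
    refine Finset.sum_congr rfl fun j _ => ?_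
    congr 1
    obtain ⟨k, hk⟩ := hb (y j) (hy j) l hl
    rw [inner_add_right, hk, Complex.exp_eq_exp_iff_exists_int]
    refine ⟨k, ?_⟩
    push_cast
    ring
  · intro γ hγ
    obtain ⟨j, hj, rfl⟩ := Finset.mem_image.1 hγ
    refine ae_trigPolynomial_ne_zero volume ?_ ⟨j, by simp [hj], (Finset.mem_filter.1 hj).2⟩
    intro i hi k hk hik
    simp only [Finset.coe_filter, Set.mem_ofPred_eq, J', Finset.mem_filter] at hi hk
    refine hinj hi.1.1 hk.1.1 (Prod.ext ?_ hik)
    exact ε.symm.injective (hi.2.trans hk.2.symm)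
  · filter_upwards [hsq] with t ht
    have h : ∑' n, ‖g (t + e n)‖ₑ ^ 2 = ∑' γ : Γ, ‖g (γ + t)‖ₑ ^ 2 := by
      rw [← ε.toEquiv.tsum_eq fun γ : Γ => ‖g (γ + t)‖ₑ ^ 2]
      simp [he, add_comm]
    rw [h]
    exact ht
  · filter_upwards [heq] with t ht
    rw [← ht, ← Finset.sum_filter_of_ne (p := fun j => c j ≠ 0)
      (fun j _ h hcj => h (by simp [hcj]))]
    rw [← Finset.sum_fiberwise_of_maps_to (s := J') (t := J'.image n)
      (fun j hj => Finset.mem_image_of_mem n hj)]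
    refine Finset.sum_congr rfl fun γ _ => ?_
    rw [Finset.sum_mul]
    refine Finset.sum_congr rfl fun j hj => ?_
    rw [← (Finset.mem_filter.1 hj).2, he]
    simp [n]

theorem Gabor.gaborSystem_coeFn {p : ℝ≥0∞}
    (f : Lp ℂ p (volume : Measure (EuclideanSpace ℝ (Fin d))))
    (A : Set (EuclideanSpace ℝ (Fin d) × EuclideanSpace ℝ (Fin d))) (a : A) :
    gaborSystem f A a =ᵐ[volume] fun t =>
      Complex.exp (2 * Real.pi * Complex.I * (inner ℝ a.1.2 t : ℝ)) * f (t - a.1.1) := by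
  have h1 := (memLp_modulateFun a.1.2 (Lp.memLp (translation a.1.1 f))).coeFn_toLp
  have h2 := (memLp_translateFun a.1.1 (Lp.memLp f)).coeFn_toLp
  filter_upwards [h1, h2] with t ht1 ht2
  refine ht1.trans ?_
  rw [modulateFun]
  exact congrArg _ ht2

end Gabor

theorem theorem1p4 (d : ℕ) (p : ℝ≥0∞) (hp0 : 0 < p) (hp2 : p ≤ 2)
    (Γ Λ : Submodule ℤ (EuclideanSpace ℝ (Fin d)))
    [DiscreteTopology Γ] [IsZLattice ℝ Γ] [DiscreteTopology Λ] [IsZLattice ℝ Λ]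
    (A : Set (EuclideanSpace ℝ (Fin d) × EuclideanSpace ℝ (Fin d)))
    (hA : ∃ z : EuclideanSpace ℝ (Fin d) × EuclideanSpace ℝ (Fin d),
      (fun a => z + a) '' A ⊆
        (Γ : Set (EuclideanSpace ℝ (Fin d))) ×ˢ (Λ : Set (EuclideanSpace ℝ (Fin d))))
    (f : Lp ℂ p (volume : Measure (EuclideanSpace ℝ (Fin d)))) (hf : f ≠ 0) :
    LinearIndependent ℂ (Gabor.gaborSystem f A) := by
  obtain ⟨z, hz⟩ := hA
  have hzA (a : A) : z.1 + a.1.1 ∈ Γ ∧ z.2 + a.1.2 ∈ Λ := hz ⟨a.1, a.2, rfl⟩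
  rw [linearIndependent_iff']
  intro s c hsum
  by_contra! hc
  apply hf
  rw [Lp.eq_zero_iff_ae_eq_zero]
  have hmp := measurePreserving_add_right (volume : Measure (EuclideanSpace ℝ (Fin d))) z.1
  have hrel : ∀ᵐ t, ∑ a ∈ s, c a *
      (Complex.exp (2 * Real.pi * Complex.I * (inner ℝ a.1.2 t : ℝ)) * f (t - a.1.1)) = 0 := by
    have h1 : ∀ᵐ t, ∀ a ∈ s, (c a • Gabor.gaborSystem f A a : Lp ℂ p volume) t =
        c a * (Complex.exp (2 * Real.pi * Complex.I * (inner ℝ a.1.2 t : ℝ)) *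
          f (t - a.1.1)) := by
      refine (ae_ball_iff s.countable_toSet).2 fun a _ => ?_
      filter_upwards [Lp.coeFn_smul (c a) (Gabor.gaborSystem f A a),
        Gabor.gaborSystem_coeFn f A a] with t h1 h2
      rw [h1, Pi.smul_apply, h2, smul_eq_mul]
    have h2 := Lp.coeFn_finsetSum s fun a => c a • Gabor.gaborSystem f A a
    rw [hsum] at h2
    filter_upwards [h1, h2, Lp.coeFn_zero ℂ p (volume : Measure (EuclideanSpace ℝ (Fin d)))]
      with t h1 h2 h3
    rw [← Finset.sum_congr rfl h1]
    simpa [h3] using h2.symm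
  have hzero : ∀ᵐ t, f (t + z.1) = 0 := by
    refine ae_eq_zero_of_timeFrequency_relation hp0 hp2 Γ Λ (J := s)
      (g := fun t => f (t + z.1))
      ((Lp.stronglyMeasurable f).measurable.comp (measurable_add_const _))
      ((Lp.memLp f).comp_measurePreserving hmp)
      (x := fun a => ⟨z.1 + a.1.1, (hzA a).1⟩) (fun a => (hzA a).2) ?_ hc ?_
    · intro a _ b _ hab
      simp only [Prod.mk.injEq, Subtype.mk.injEq, add_right_inj] at hab
      exact Subtype.ext (Prod.ext hab.1 hab.2)
    · filter_upwards [hrel] with t ht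
      -- Modulating by z.2 moves the frequencies into Λ.
      have h := congrArg (Complex.exp (2 * Real.pi * Complex.I * (inner ℝ z.2 t : ℝ)) * ·) ht
      simp only [mul_zero, Finset.mul_sum] at h
      rw [← h]
      refine Finset.sum_congr rfl fun a _ => ?_
      rw [inner_add_left, Complex.ofReal_add, mul_add, Complex.exp_add,
        show t - (z.1 + a.1.1) + z.1 = t - a.1.1 by abel]
      ring
  have h := (measurePreserving_sub_right volume z.1).quasiMeasurePreserving.ae hzero
  simp only [sub_add_cancel] at h
  exact h
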